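/- Let $G$ be a finite group, let $I$ and $\Lambda$ be finite sets, and let $P=(p_{\lambda i})$ be a $\Lambda\times I$ matrix with entries in $G\cup\{0\}$. Let $S=\mathcal M^0[G;I,\Lambda;P]$ be the Rees matrix semigroup $(I\times G\times\Lambda)\cup\{0\}$ with product $(i,g,\lambda)(j,h,\mu)=(i,g\,p_{\lambda j}h,\mu)$ if $p_{\lambda j}\neq 0$, and all other products equal to $0$; $P$ is not assumed to be regular. The graph of a matrix with rows $\Lambda$ and columns $I$ is the bipartite graph on $I\sqcup\Lambda$ in which $i$ and $\lambda$ are adjacent if and only if the entry at $(\lambda,i)$ is non-zero. Suppose that $P$ is in Graham normal form $$P=\begin{pmatrix}C_R&0\\0&C_N\end{pmatrix},\qquad C_R=\begin{pmatrix}C_1&&\\&\ddots&\\&&C_n\end{pmatrix},$$ that is: $C_N$ is the zero matrix on $\Lambda'\times I'$, where $I'\subseteq I$ and $\Lambda'\subseteq\Lambda$; the sets $I\setminus I'$ and $\Lambda\setminus\Lambda'$ are partitioned as $I_1\cup\dots\cup I_n$ and $\Lambda_1\cup\dots\cup\Lambda_n$; all entries of $P$ outside of the blocks $\Lambda_k\times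 I_k$ are $0$; each block $C_k:\Lambda_k\times I_k\to G\cup\{0\}$ is regular (every row and every column has a non-zero entry) and has a connected graph; and there is a spanning forest of the graph of $P$ such that $p_{\lambda i}=1_G$ for each of its edges $\{i,\lambda\}$. The rank of $S$, written $\operatorname{rank}(S)$, is the least cardinality of a set $A\subseteq S$ such that every non-zero element of $S$ is a product of elements of $A$ (the element $0$ is always included in a generated subsemigroup). For a subset $A\subseteq G$ let $\operatorname{rank}(G:A)=\min\{|X|: X\subseteq G,\ \langle A\cup X\rangle=G\}$. Let $H_k$ be the subgroup of $G$ generated by the non-zero entries of $C_k$, and put $$\sigma_{\min}=\min\Big\{\operatorname{rank}\Big(G:\bigcup_{k=1}^n g_kH_kg_k^{-1}\Big)\;:\;g_1,\dots,g_n\in G\Big\}.$$ If $P$ is a zero matrix, then $\operatorname{rank}(S)=|G||I||\Lambda|$. Otherwise $$\operatorname{rank}(S)=\max\big(|I\setminus I'|,\ |\Lambda\setminus\Lambda'|,\ \sigma_{\min}+n-1\big)+|I'|+|\Lambda'|.$$ -/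

import Mathlib

/-- The underlying set `(I × G × Λ) ∪ {0}` of the Rees matrix semigroup `M⁰[G; I, Λ; P]` over the
group `G`, with structure matrix `P : Λ × I → G ∪ {0}`. -/
inductive ReesMatrixSemigroup {G I Λ : Type*} (P : Matrix Λ I (WithZero G)) where
  | zero : ReesMatrixSemigroup P
  | elem (i : I) (g : G) (l : Λ) : ReesMatrixSemigroup P

namespace ReesMatrixSemigroup

variable {G I Λ : Type*} [Group G] {P : Matrix Λ I (WithZero G)}

/-- `(i, g, l) (j, h, m) = (i, g p h, m)` if the entry `P l j` is `p ∈ G`, and `0` if it is `0`;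
products with `0` are `0`. -/
def mul : ReesMatrixSemigroup P → ReesMatrixSemigroup P → ReesMatrixSemigroup P
  | elem i g l, elem j h m => WithZero.recZeroCoe zero (fun p : G => elem i (g * p * h) m) (P l j)
  | zero, _ => zero
  | elem _ _ _, zero => zero

instance : SemigroupWithZero (ReesMatrixSemigroup P) where
  mul := mul
  zero := zero
  zero_mul := fun _ => rfl
  mul_zero := fun a => by cases a <;> rfl
  mul_assoc := fun a b c => by
    change mul (mul a b) c = mul a (mul b c)
    rcases a with _ | ⟨i, g, l⟩
    · rfl
    rcases b with _ | ⟨j, h, m⟩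
    · rfl
    rcases c with _ | ⟨k, x, r⟩
    · simp only [mul]
      induction P l j using WithZero.recZeroCoe <;> rfl
    · simp only [mul]
      induction hp : P l j using WithZero.recZeroCoe <;>
        induction hq : P m k using WithZero.recZeroCoe <;>
        simp [hp, hq, mul_assoc]

end ReesMatrixSemigroup

/-- The relative rank of a semigroup `S` modulo `A`: the least number of elements that have to be
added to `A` in order to generate `S` as a semigroup. -/
noncomputable def relativeRank (S : Type*) [Semigroup S] (A : Set S) : ℕ :=
  sInf {m : ℕ | ∃ X : Finset S, X.card = m ∧ Subsemigroup.closure (A ∪ (X : Set S)) = ⊤}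

/-- The rank of a semigroup with zero: the least number of elements whose products, together with
`0` (which is always included in a generated subsemigroup), exhaust `S`. -/
noncomputable def rankWithZero (S : Type*) [SemigroupWithZero S] : ℕ :=
  sInf {m : ℕ | ∃ A : Finset S, A.card = m ∧
    (Subsemigroup.closure (A : Set S) : Set S) ∪ {0} = Set.univ}

section

variable {G I Λ : Type*}

/-- The Graham–Houghton graph of `P`: the bipartite graph on `I ⊔ Λ` in which `i ∈ I` and `l ∈ Λ`
are adjacent iff `P l i ≠ 0`. -/
def grahamHoughtonGraph (P : Matrix Λ I (WithZero G)) : SimpleGraph (I ⊕ Λ) where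
  Adj
    | .inl i, .inr l => P l i ≠ 0
    | .inr l, .inl i => P l i ≠ 0
    | _, _ => False
  symm := ⟨by rintro (i | l) (j | m) h <;> exact h⟩
  loopless := ⟨by rintro (i | l) h <;> exact h⟩

/-- A matrix is regular if every row and every column has a non-zero entry. -/
def IsRegularMatrix (P : Matrix Λ I (WithZero G)) : Prop :=
  (∀ l, ∃ i, P l i ≠ 0) ∧ ∀ i, ∃ l, P l i ≠ 0

/-- `F` is a spanning forest of `Γ`: an acyclic subgraph with the same connected components. -/
def IsSpanningForest {V : Type*} (F Γ : SimpleGraph V) : Prop :=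
  F ≤ Γ ∧ F.IsAcyclic ∧ ∀ u v, Γ.Reachable u v → F.Reachable u v

/-- The submatrix of `P` with rows in `L` and columns in `J`. -/
def matrixBlock (P : Matrix Λ I (WithZero G)) (L : Set Λ) (J : Set I) :
    Matrix L J (WithZero G) :=
  P.submatrix Subtype.val Subtype.val

/-- `P` is in Graham normal form with zero block on `Λ' × I'` and diagonal blocks
`C_k` on `Λb k × Ib k`, `k = 1, …, n`. -/
structure IsGrahamNormalForm [Group G] (P : Matrix Λ I (WithZero G)) (I' : Set I) (Λ' : Set Λ)
    {n : ℕ} (Ib : Fin n → Set I) (Λb : Fin n → Set Λ) : Prop where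
  /-- The sets `Ib k` partition `I ∖ I'`. -/
  disjoint_cols : Pairwise fun j k => Disjoint (Ib j) (Ib k)
  iUnion_cols : (⋃ k, Ib k) = I'ᶜ
  /-- The sets `Λb k` partition `Λ ∖ Λ'`. -/
  disjoint_rows : Pairwise fun j k => Disjoint (Λb j) (Λb k)
  iUnion_rows : (⋃ k, Λb k) = Λ'ᶜ
  /-- All entries outside of the diagonal blocks are zero. -/
  zero_off_blocks : ∀ l i, (¬ ∃ k, l ∈ Λb k ∧ i ∈ Ib k) → P l i = 0
  /-- The diagonal blocks are regular and connected. -/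
  regular_block : ∀ k, IsRegularMatrix (matrixBlock P (Λb k) (Ib k))
  connected_block : ∀ k, (grahamHoughtonGraph (matrixBlock P (Λb k) (Ib k))).Connected
  /-- `P` is normalized: its entries along the edges of some spanning forest are `1`. -/
  normalized : ∃ F : SimpleGraph (I ⊕ Λ), IsSpanningForest F (grahamHoughtonGraph P) ∧
    ∀ i l, F.Adj (.inl i) (.inr l) → P l i = ((1 : G) : WithZero G)

/-- The subgroup of `G` generated by the non-zero entries of a matrix over `G ∪ {0}`. -/
def entrySubgroup [Group G] (C : Matrix Λ I (WithZero G)) : Subgroup G :=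
  Subgroup.closure {g : G | ∃ l i, C l i = (g : WithZero G)}

/-- `σ_min`: the minimum over `g₁, …, gₙ ∈ G` of the relative rank of `G` modulo
`⋃ k, g_k H_k g_k⁻¹`. -/
noncomputable def sigmaMin [Group G] {n : ℕ} (H : Fin n → Subgroup G) : ℕ :=
  sInf (Set.range fun g : Fin n → G =>
    relativeRank G (⋃ k, (fun h => g k * h * (g k)⁻¹) '' (H k : Set G)))

end

/-! The case `P = 0` is immediate, all products being zero. Otherwise call a generator core if its
row and column are both outside the zero block. Each column of `I'` and each row of `Λ'` costs
exactly one further generator, so the question is how many core generators are needed.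

Read a core generator `(i, g, l)` as an arrow labelled `g` from the block of `i` to the block of
`l`. A non-zero product continues inside the block just reached, picking up an entry of `P`.
Generation forces the arrows to leave every proper set of blocks, so `n - 1` of them form a spanning
tree (`exists_spanning_arrows`). Conjugating by a potential `θ` makes the tree labels trivial. The
other labels, together with the conjugates of the `H_k`, must generate `G`, which gives the bound
`σ_min + n - 1`. The bounds by columns and rows come from looking at first and last factors.

Conversely, spread `r` generators over all core rows and columns, and re-pair rows with columns
until the digraph of possible products is strongly connected (`exists_perm_transGen`). Put trivial
normalized labels on a spanning tree and an optimal relative generating set on other arrows. As `G`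
is finite, walks can be inverted (`LabelledWalk.inv`), so the normalized labels of walks form a
subgroup, which is all of `G`. -/

/-! ### Making a digraph strongly connected by permuting out-neighbourhoods -/

section StrongConnectivity

open Relation

variable {α : Type*}

/-- In a finite digraph without sinks, every vertex leads to a vertex lying on a cycle. -/
theorem exists_transGen_self_of_serial [Finite α] {r : α → α → Prop} (hr : ∀ a, ∃ b, r a b)
    (a : α) : ∃ c, TransGen r a c ∧ TransGen r c c := by
  choose next hnext using hr
  have hlt : ∀ d m, TransGen r (next^[m] a) (next^[m + d + 1] a) := by
    intro d m
    induction d with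
    | zero =>
      rw [add_zero, Function.iterate_succ_apply']
      exact .single (hnext _)
    | succ d ih =>
      refine ih.tail ?_
      rw [show m + (d + 1) + 1 = (m + d + 1) + 1 by omega,
        Function.iterate_succ_apply' next (m + d + 1)]
      exact hnext _
  obtain ⟨p, q, hpq, heq⟩ := Finite.exists_ne_map_eq_of_infinite fun m : ℕ => next^[m + 1] a
  wlog hlt' : p < q generalizing p q
  · exact this q p hpq.symm heq.symm (by omega)
  refine ⟨next^[p + 1] a, ?_, ?_⟩
  · simpa using hlt p 0
  · have := hlt (q - p - 1) (p + 1)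
    rw [show p + 1 + (q - p - 1) + 1 = q + 1 by omega] at this
    rwa [← heq] at this

/-- Exchanging the out-neighbourhoods of two vertices `a`, `b` lying on cycles, where `a` does not
lead to `b`, enlarges the reachability relation and makes `a` lead to `b`. -/
theorem transGen_exchange [DecidableEq α] {Q : α → α → Prop} {a b : α}
    (ha : TransGen Q a a) (hb : TransGen Q b b) (hab : ¬ TransGen Q a b) :
    (∀ u v, TransGen Q u v → TransGen (fun x y => Q (Equiv.swap a b x) y) u v) ∧
      TransGen (fun x y => Q (Equiv.swap a b x) y) a b := by
  set Q' : α → α → Prop := fun x y => Q (Equiv.swap a b x) y with hQ'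
  have hsame : ∀ x y, x ≠ a → x ≠ b → Q x y → Q' x y := by
    intro x y hxa hxb h
    simpa [hQ', Equiv.swap_apply_of_ne_of_ne hxa hxb] using h
  have hA : ∀ y, Q a y → Q' b y := fun y h => by simpa [hQ'] using h
  have hB : ∀ y, Q b y → Q' a y := fun y h => by simpa [hQ'] using h
  -- A path to `b` never meets `a`, since `a` does not lead to `b`; up to its first visit to `b` it
  -- uses only unaltered edges.
  have toB : ∀ x, ReflTransGen Q x b → ReflTransGen Q' x b := by
    intro x hx
    induction hx using ReflTransGen.head_induction_on with
    | refl => exact .refl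
    | head hcd hd ih =>
      rename_i c d
      by_cases hcb : c = b
      · subst hcb; exact .refl
      · have hca : c ≠ a := by
          rintro rfl
          exact hab (TransGen.head' hcd hd)
        exact .head (hsame _ _ hca hcb hcd) ih
  -- Everything on such a path is reachable from `a`, hence differs from `b`.
  have toA : ∀ x, ReflTransGen Q x a → TransGen Q a x → ReflTransGen Q' x a := by
    intro x hx
    induction hx using ReflTransGen.head_induction_on with
    | refl => exact fun _ => .refl
    | head hcd hd ih =>
      rename_i c d
      intro hac
      by_cases hca : c = a
      · subst hca; exact .refl
      · have hcb : c ≠ b := by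
          rintro rfl
          exact hab hac
        exact .head (hsame _ _ hca hcb hcd) (ih (hac.tail hcd))
  have hab' : TransGen Q' a b := by
    obtain ⟨c, hbc, hc⟩ := TransGen.head'_iff.1 hb
    exact TransGen.head' (hB _ hbc) (toB _ hc)
  have hba' : TransGen Q' b a := by
    obtain ⟨c, hac, hc⟩ := TransGen.head'_iff.1 ha
    exact TransGen.head' (hA _ hac) (toA _ hc (.single hac))
  refine ⟨fun u v huv => ?_, hab'⟩
  have step : ∀ x y, Q x y → TransGen Q' x y := by
    intro x y hxy
    by_cases hxa : x = a
    · subst hxa; exact hab'.tail (hA _ hxy)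
    by_cases hxb : x = b
    · subst hxb; exact hba'.tail (hB _ hxy)
    exact .single (hsame _ _ hxa hxb hxy)
  induction huv with
  | single h => exact step _ _ h
  | tail _ h ih => exact ih.trans (step _ _ h)

/-- The out-neighbourhoods of a finite digraph without sinks and sources can be permuted so that
the digraph becomes strongly connected. -/
theorem exists_perm_transGen [Finite α] {Q : α → α → Prop} (hout : ∀ a, ∃ b, Q a b)
    (hin : ∀ b, ∃ a, Q a b) :
    ∃ π : Equiv.Perm α, ∀ a b, TransGen (fun x y => Q (π x) y) a b := by
  classical
  let reach : Equiv.Perm α → Set (α × α) := fun π =>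
    {p | TransGen (fun x y => Q (π x) y) p.1 p.2}
  -- For a permutation with maximal reachability relation no exchange can be profitable, so any two
  -- vertices on cycles reach each other.
  obtain ⟨π, hπ⟩ := Finite.exists_max fun π => (reach π).ncard
  have hcyc : ∀ a b, TransGen (fun x y => Q (π x) y) a a → TransGen (fun x y => Q (π x) y) b b →
      TransGen (fun x y => Q (π x) y) a b := by
    intro a b ha hb
    by_contra hab
    obtain ⟨hsub, hnew⟩ := transGen_exchange ha hb hab
    have hlt : (reach π).ncard < (reach (π * Equiv.swap a b)).ncard := by
      refine Set.ncard_lt_ncard ⟨fun p hp => hsub _ _ hp, fun h => hab ?_⟩ (Set.toFinite _)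
      exact h (show (a, b) ∈ reach (π * Equiv.swap a b) from hnew)
    exact absurd (hπ _) (not_le.2 hlt)
  refine ⟨π, fun a b => ?_⟩
  obtain ⟨c, hac, hcc⟩ := exists_transGen_self_of_serial (r := fun x y => Q (π x) y)
    (fun x => hout _) a
  obtain ⟨d, hbd, hdd⟩ := exists_transGen_self_of_serial
    (r := Function.swap fun x y => Q (π x) y)
    (fun x => by
      obtain ⟨y, hy⟩ := hin x
      exact ⟨π.symm y, by simpa [Function.swap] using hy⟩) b
  exact (hac.trans (hcyc c d hcc (transGen_swap.1 hdd))).trans (transGen_swap.1 hbd)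

end StrongConnectivity

/-! ### Spanning trees of arrows and potentials -/

/-- In a finite family of arrows between the elements of `κ` along which one can leave every
non-empty proper subset of `κ`, there are `|κ| - 1` arrows which connect all of `κ` and on which
every labelling by group elements is a coboundary. -/
theorem exists_spanning_arrows {G α κ : Type*} [Group G] [Fintype κ] [Nonempty κ]
    (A : Finset α) (s t : α → κ)
    (h : ∀ V : Finset κ, V.Nonempty → V ≠ Finset.univ → ∃ a ∈ A, s a ∈ V ∧ t a ∉ V) :
    ∃ T ⊆ A, T.card + 1 = Fintype.card κ ∧
      (∀ x : α → G, ∃ g : κ → G, ∀ a ∈ T, g (s a) * x a * (g (t a))⁻¹ = 1) ∧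
      ∀ r : Setoid κ, (∀ a ∈ T, r (s a) (t a)) → ∀ u v, r u v := by
  classical
  have key : ∀ m < Fintype.card κ, ∃ V : Finset κ, V.card = m + 1 ∧ ∃ T ⊆ A, T.card = m ∧
      (∀ a ∈ T, s a ∈ V ∧ t a ∈ V) ∧
      (∀ x : α → G, ∃ g : κ → G, ∀ a ∈ T, g (s a) * x a * (g (t a))⁻¹ = 1) ∧
      ∀ r : Setoid κ, (∀ a ∈ T, r (s a) (t a)) → ∀ u ∈ V, ∀ v ∈ V, r u v := by
    intro m
    induction m with
    | zero =>
      intro _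
      obtain ⟨k⟩ := ‹Nonempty κ›
      refine ⟨{k}, by simp, ∅, by simp, by simp, by simp, fun x => ⟨1, by simp⟩, ?_⟩
      intro r _ u hu v hv
      rw [Finset.mem_singleton] at hu hv
      subst hu; subst hv
      exact r.refl _
    | succ m ih =>
      intro hm
      obtain ⟨V, hV, T, hTA, hT, hTV, hg, hr⟩ := ih (by omega)
      obtain ⟨a, haA, hs, ht⟩ := h V (Finset.card_pos.1 (by omega)) (by
        rintro rfl
        rw [Finset.card_univ] at hV
        omega)
      have haT : a ∉ T := fun ha => ht (hTV a ha).2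
      refine ⟨insert (t a) V, by rw [Finset.card_insert_of_notMem ht, hV], insert a T,
        Finset.insert_subset haA hTA, by rw [Finset.card_insert_of_notMem haT, hT], ?_, ?_, ?_⟩
      · intro b hb
        rcases Finset.mem_insert.1 hb with rfl | hb
        · exact ⟨Finset.mem_insert_of_mem hs, Finset.mem_insert_self _ _⟩
        · exact ⟨Finset.mem_insert_of_mem (hTV b hb).1, Finset.mem_insert_of_mem (hTV b hb).2⟩
      · intro x
        obtain ⟨g, hg⟩ := hg x
        -- The value at the new vertex is forced by the new arrow; the old arrows lie in `V`, where
        -- the potential is unchanged.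
        refine ⟨Function.update g (t a) (g (s a) * x a), fun b hb => ?_⟩
        rcases Finset.mem_insert.1 hb with rfl | hb
        · have : s b ≠ t b := fun e => ht (e ▸ hs)
          simp [Function.update_of_ne this]
        · have h1 : s b ≠ t a := fun e => ht (e ▸ (hTV b hb).1)
          have h2 : t b ≠ t a := fun e => ht (e ▸ (hTV b hb).2)
          rw [Function.update_of_ne h1, Function.update_of_ne h2]
          exact hg b hb
      · intro r hrT
        have hV' := hr r fun b hb => hrT b (Finset.mem_insert_of_mem hb)
        have hsa : r (s a) (t a) := hrT a (Finset.mem_insert_self _ _)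
        have hbase : ∀ u ∈ insert (t a) V, r (s a) u := by
          intro u hu
          rcases Finset.mem_insert.1 hu with rfl | hu
          · exact hsa
          · exact hV' _ hs _ hu
        exact fun u hu v hv => r.trans (r.symm (hbase u hu)) (hbase v hv)
  have hpos : 0 < Fintype.card κ := Fintype.card_pos
  obtain ⟨V, hV, T, hTA, hT, -, hg, hr⟩ := key (Fintype.card κ - 1) (by omega)
  have hVu : V = Finset.univ := by
    rw [← Finset.card_eq_iff_eq_univ]; omega
  subst hVu
  exact ⟨T, hTA, by omega, hg, fun r hrT u v => hr r hrT u (Finset.mem_univ _) v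
    (Finset.mem_univ _)⟩

/-! ### Walks in group-labelled digraphs -/

/-- `LabelledWalk E u g v`: in the digraph with `G`-labelled edges `E`, there is a walk from `u` to
`v` whose labels multiply to `g`. -/
inductive LabelledWalk {V G : Type*} [Group G] (E : V → G → V → Prop) : V → G → V → Prop
  | refl (u : V) : LabelledWalk E u 1 u
  | tail {u v w : V} {g x : G} : LabelledWalk E u g v → E v x w → LabelledWalk E u (g * x) w

namespace LabelledWalk

variable {V G : Type*} [Group G] {E : V → G → V → Prop}

theorem single {u v : V} {x : G} (h : E u x v) : LabelledWalk E u x v := by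
  simpa using (refl (E := E) u).tail h

theorem trans {u v w : V} {g x : G} (h : LabelledWalk E u g v) (h' : LabelledWalk E v x w) :
    LabelledWalk E u (g * x) w := by
  induction h' with
  | refl => simpa using h
  | tail _ he ih => rw [← mul_assoc]; exact ih.tail he

theorem pow {u : V} {g : G} (h : LabelledWalk E u g u) (m : ℕ) : LabelledWalk E u (g ^ m) u := by
  induction m with
  | zero => simpa using refl u
  | succ m ih => rw [pow_succ]; exact ih.trans h

/-- Over a finite group, a walk that can be continued to a closed walk can be inverted. -/
theorem inv [Finite G] {u v : V} {g q : G} (h : LabelledWalk E u g v)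
    (h' : LabelledWalk E v q u) : LabelledWalk E v g⁻¹ u := by
  have hpos := orderOf_pos (g * q)
  have := h'.trans ((h.trans h').pow (orderOf (g * q) - 1))
  have heq : (g * q) ^ (orderOf (g * q) - 1) = (g * q)⁻¹ := by
    rw [eq_inv_iff_mul_eq_one, ← pow_succ, Nat.sub_add_cancel hpos, pow_orderOf_eq_one]
  rw [heq] at this
  simpa using this

end LabelledWalk

/-! ### Products and rank in a Rees matrix semigroup -/

namespace ReesMatrixSemigroup

variable {G I Λ : Type*} [Group G] {P : Matrix Λ I (WithZero G)}

theorem elem_mul_elem {l : Λ} {j : I} {p : G} (hp : P l j = p) (i : I) (g h : G) (m : Λ) :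
    (elem i g l * elem j h m : ReesMatrixSemigroup P) = elem i (g * p * h) m := by
  change mul _ _ = _
  simp [mul, hp]

theorem elem_mul_elem_of_eq_zero {l : Λ} {j : I} (hp : P l j = 0) (i : I) (g h : G) (m : Λ) :
    (elem i g l * elem j h m : ReesMatrixSemigroup P) = 0 := by
  change mul _ _ = _
  simp only [mul, hp]
  rfl

theorem elem_ne_zero (i : I) (g : G) (l : Λ) : (elem i g l : ReesMatrixSemigroup P) ≠ 0 :=
  fun h => nomatch (show elem i g l = zero from h)

/-- Induction over the non-zero products of elements of `A`. -/
theorem closure_elem_induction {A : Set (ReesMatrixSemigroup P)} {p : I → G → Λ → Prop}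
    (gen : ∀ i g l, elem i g l ∈ A → p i g l)
    (mul : ∀ i g l j h m (x : G), P l j = x → p i g l → p j h m → p i (g * x * h) m)
    {i : I} {g : G} {l : Λ} (h : elem i g l ∈ Subsemigroup.closure A) : p i g l := by
  have key : ∀ s ∈ Subsemigroup.closure A, ∀ i g l, s = elem i g l → p i g l := by
    intro s hs
    induction hs using Subsemigroup.closure_induction with
    | mem x hx => rintro i g l rfl; exact gen _ _ _ hx
    | mul x y _ _ ihx ihy =>
      intro i g l hxy
      rcases x with _ | ⟨i₁, g₁, l₁⟩
      · exact absurd hxy (by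
          rw [show (zero * y : ReesMatrixSemigroup P) = 0 from zero_mul y]
          exact (elem_ne_zero _ _ _).symm)
      rcases y with _ | ⟨i₂, g₂, l₂⟩
      · exact absurd hxy (by
          rw [show (elem i₁ g₁ l₁ * zero : ReesMatrixSemigroup P) = 0 from mul_zero _]
          exact (elem_ne_zero _ _ _).symm)
      induction hq : P l₁ i₂ using WithZero.recZeroCoe with
      | zero =>
        rw [elem_mul_elem_of_eq_zero hq] at hxy
        exact absurd hxy.symm (elem_ne_zero _ _ _)
      | coe x =>
        rw [elem_mul_elem hq] at hxy
        cases hxy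
        exact mul _ _ _ _ _ _ _ hq (ihx _ _ _ rfl) (ihy _ _ _ rfl)
  exact key _ h _ _ _ rfl

theorem closure_union_zero_eq_univ_iff (A : Set (ReesMatrixSemigroup P)) :
    (Subsemigroup.closure A : Set (ReesMatrixSemigroup P)) ∪ {0} = Set.univ ↔
      ∀ i g l, elem i g l ∈ Subsemigroup.closure A := by
  rw [Set.eq_univ_iff_forall]
  constructor
  · intro h i g l
    exact (h (elem i g l)).resolve_right (elem_ne_zero i g l)
  · rintro h (_ | ⟨i, g, l⟩)
    · exact Or.inr rfl
    · exact Or.inl (h i g l)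

/-- Since `sInf ∅ = 0`, the lower bound also needs the generating set from `upper`: it makes the
infimum an attained value. -/
theorem rankWithZero_eq {m : ℕ}
    (lower : ∀ A : Finset (ReesMatrixSemigroup P),
      (∀ i g l, elem i g l ∈ Subsemigroup.closure (A : Set (ReesMatrixSemigroup P))) → m ≤ A.card)
    (upper : ∃ A : Finset (ReesMatrixSemigroup P), A.card ≤ m ∧
      ∀ i g l, elem i g l ∈ Subsemigroup.closure (A : Set (ReesMatrixSemigroup P))) :
    rankWithZero (ReesMatrixSemigroup P) = m := by
  obtain ⟨A, hAm, hA⟩ := upper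
  have hAmem : A.card ∈ {m : ℕ | ∃ A : Finset (ReesMatrixSemigroup P), A.card = m ∧
      (Subsemigroup.closure (A : Set (ReesMatrixSemigroup P)) :
        Set (ReesMatrixSemigroup P)) ∪ {0} = Set.univ} :=
    ⟨A, rfl, (closure_union_zero_eq_univ_iff _).2 hA⟩
  refine le_antisymm ((Nat.sInf_le hAmem).trans hAm) ?_
  obtain ⟨B, hB, hB'⟩ := Nat.sInf_mem ⟨_, hAmem⟩
  rw [rankWithZero, ← hB]
  exact lower B ((closure_union_zero_eq_univ_iff _).1 hB')

theorem rankWithZero_of_eq_zero [Finite G] [Finite I] [Finite Λ] (hP : P = 0) :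
    rankWithZero (ReesMatrixSemigroup P) = Nat.card G * Nat.card I * Nat.card Λ := by
  classical
  have hinj : Function.Injective
      fun t : I × G × Λ => (elem t.1 t.2.1 t.2.2 : ReesMatrixSemigroup P) := by
    rintro ⟨i, g, l⟩ ⟨j, h, m⟩ e
    cases e
    rfl
  have hcard : Nat.card G * Nat.card I * Nat.card Λ = Nat.card (I × G × Λ) := by
    rw [Nat.card_prod, Nat.card_prod]; ring
  have := Fintype.ofFinite (I × G × Λ)
  rw [hcard, Nat.card_eq_fintype_card, ← Finset.card_univ, ← Finset.card_image_of_injective _ hinj]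
  refine rankWithZero_eq (fun A hA => Finset.card_le_card ?_) ⟨_, le_rfl, fun i g l => ?_⟩
  · intro s hs
    obtain ⟨⟨i, g, l⟩, -, rfl⟩ := Finset.mem_image.1 hs
    refine closure_elem_induction (p := fun i g l => elem i g l ∈ A) (fun _ _ _ h => h) ?_ (hA i g l)
    intro i g l j h m x hx
    simp [hP] at hx
  · exact Subsemigroup.subset_closure
      (by simp)

end ReesMatrixSemigroup

/-! ### Blocks of the Graham normal form -/

/-- The index function of a partition of the complement of `J'` into sets `B k`. -/
theorem exists_index_of_partition {J κ : Type*} [Nonempty κ] {J' : Set J} {B : κ → Set J}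
    (hdisj : Pairwise fun j k => Disjoint (B j) (B k)) (hB : (⋃ k, B k) = J'ᶜ) :
    ∃ c : J → κ, ∀ i k, i ∈ B k ↔ i ∉ J' ∧ c i = k := by
  classical
  have hmem : ∀ i, i ∉ J' ↔ ∃ k, i ∈ B k := by
    intro i
    rw [← Set.mem_compl_iff, ← hB, Set.mem_iUnion]
  have hex : ∀ i, ∃ k, i ∉ J' → i ∈ B k := by
    intro i
    by_cases hi : i ∈ J'
    · exact ⟨Classical.arbitrary κ, fun h => absurd hi h⟩
    · obtain ⟨k, hk⟩ := (hmem i).1 hi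
      exact ⟨k, fun _ => hk⟩
  choose c hc using hex
  refine ⟨c, fun i k => ⟨fun hi => ?_, ?_⟩⟩
  · have hi' := (hmem i).2 ⟨k, hi⟩
    refine ⟨hi', ?_⟩
    by_contra hne
    exact Set.disjoint_left.1 (hdisj hne) (hc i hi') hi
  · rintro ⟨hi, rfl⟩
    exact hc i hi

section Components

variable {G I Λ : Type*} [Group G] {P : Matrix Λ I (WithZero G)} {I' : Set I} {Λ' : Set Λ}
  {n : ℕ} {Ib : Fin n → Set I} {Λb : Fin n → Set Λ}

namespace IsGrahamNormalForm

theorem exists_block (hP : IsGrahamNormalForm P I' Λ' Ib Λb) {l : Λ} {i : I} (h : P l i ≠ 0) :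
    ∃ k, l ∈ Λb k ∧ i ∈ Ib k := by
  by_contra hk
  exact h (hP.zero_off_blocks l i hk)

/-- Hence `n ≥ 1`, and the truncated subtraction in `σ_min + n - 1` is harmless. -/
theorem nonempty_index (hP : IsGrahamNormalForm P I' Λ' Ib Λb) (h : P ≠ 0) : Nonempty (Fin n) := by
  by_contra hn
  refine h (Matrix.ext fun l i => hP.zero_off_blocks l i ?_)
  rintro ⟨k, -⟩
  exact hn ⟨k⟩

theorem exists_ne_zero (hP : IsGrahamNormalForm P I' Λ' Ib Λb) (k : Fin n) :
    ∃ i ∈ Ib k, ∃ l ∈ Λb k, P l i ≠ 0 := by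
  obtain ⟨i | l⟩ := (hP.connected_block k).nonempty
  · obtain ⟨l, hl⟩ := (hP.regular_block k).2 i
    exact ⟨i, i.2, l, l.2, hl⟩
  · obtain ⟨i, hi⟩ := (hP.regular_block k).1 l
    exact ⟨i, i.2, l, l.2, hi⟩

/-- The functions assigning to a column or a row its diagonal block. -/
theorem exists_component (hP : IsGrahamNormalForm P I' Λ' Ib Λb) (h : P ≠ 0) :
    ∃ (c : I → Fin n) (d : Λ → Fin n), (∀ i k, i ∈ Ib k ↔ i ∉ I' ∧ c i = k) ∧
      ∀ l k, l ∈ Λb k ↔ l ∉ Λ' ∧ d l = k := by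
  have := hP.nonempty_index h
  obtain ⟨c, hc⟩ := exists_index_of_partition hP.disjoint_cols hP.iUnion_cols
  obtain ⟨d, hd⟩ := exists_index_of_partition hP.disjoint_rows hP.iUnion_rows
  exact ⟨c, d, hc, hd⟩

/-- A relation holding along all entries equal to `1` relates all rows and columns of a block. -/
theorem setoid_rel_of_block (hP : IsGrahamNormalForm P I' Λ' Ib Λb) (ρ : Setoid (I ⊕ Λ))
    (hρ : ∀ i l, P l i = ((1 : G) : WithZero G) → ρ (.inl i) (.inr l)) (k : Fin n)
    (u v : Ib k ⊕ Λb k) :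
    ρ (Sum.map Subtype.val Subtype.val u) (Sum.map Subtype.val Subtype.val v) := by
  obtain ⟨F, ⟨hle, -, hF⟩, hF1⟩ := hP.normalized
  let φ : grahamHoughtonGraph (matrixBlock P (Λb k) (Ib k)) →g grahamHoughtonGraph P :=
    ⟨Sum.map Subtype.val Subtype.val, by rintro (i | l) (j | m) h <;> exact h⟩
  -- Connectedness of the block passes to the graph of `P` and from there to the forest, whose edges
  -- all carry the entry `1`.
  have hreach := hF _ _ (((hP.connected_block k).preconnected u v).map φ)
  change F.Reachable (Sum.map Subtype.val Subtype.val u) (Sum.map Subtype.val Subtype.val v)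
    at hreach
  have hadj : ∀ a b, F.Adj a b → ρ a b := by
    rintro (i | l) (j | m) h
    · exact absurd (hle h) (fun h => h)
    · exact hρ _ _ (hF1 _ _ h)
    · exact ρ.symm (hρ _ _ (hF1 _ _ h.symm))
    · exact absurd (hle h) (fun h => h)
  generalize Sum.map Subtype.val Subtype.val u = a, Sum.map Subtype.val Subtype.val v = b at hreach
  obtain ⟨w⟩ := hreach
  induction w with
  | nil => exact ρ.refl _
  | cons h _ ih => exact ρ.trans (hadj _ _ h) ih

end IsGrahamNormalForm

end Components

/-! ### The lower bound -/

namespace ReesMatrixSemigroup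

variable {G I Λ : Type*} {P : Matrix Λ I (WithZero G)} {I' : Set I} {Λ' : Set Λ}

/-- The elements of `A` lying in a non-zero row and a non-zero column. -/
noncomputable def corePart (I' : Set I) (Λ' : Set Λ) (A : Finset (ReesMatrixSemigroup P)) :
    Finset (ReesMatrixSemigroup P) :=
  open Classical in A.filter fun s => ∃ i g l, s = elem i g l ∧ i ∉ I' ∧ l ∉ Λ'

theorem elem_mem_corePart {A : Finset (ReesMatrixSemigroup P)} {i : I} {g : G} {l : Λ} :
    elem i g l ∈ corePart I' Λ' A ↔ elem i g l ∈ A ∧ i ∉ I' ∧ l ∉ Λ' := by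
  classical
  rw [corePart, Finset.mem_filter]
  refine and_congr_right fun _ => ⟨?_, fun h => ⟨i, g, l, rfl, h⟩⟩
  rintro ⟨j, h, m, e, hh⟩
  cases e
  exact hh

end ReesMatrixSemigroup

section LowerBound

open ReesMatrixSemigroup

variable {G I Λ : Type*} [Group G] {P : Matrix Λ I (WithZero G)} {I' : Set I} {Λ' : Set Λ}
  {n : ℕ} {Ib : Fin n → Set I} {Λb : Fin n → Set Λ}

namespace IsGrahamNormalForm

theorem notMem_of_ne_zero (hP : IsGrahamNormalForm P I' Λ' Ib Λb) {l : Λ} {i : I}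
    (h : P l i ≠ 0) : i ∉ I' ∧ l ∉ Λ' := by
  obtain ⟨k, hl, hi⟩ := hP.exists_block h
  exact ⟨hP.iUnion_cols.subset (Set.mem_iUnion.2 ⟨k, hi⟩),
    hP.iUnion_rows.subset (Set.mem_iUnion.2 ⟨k, hl⟩)⟩

/-- A generating set contains an element in every column, with a non-zero row. -/
theorem exists_generator_col (hP : IsGrahamNormalForm P I' Λ' Ib Λb) (hne : P ≠ 0)
    {A : Set (ReesMatrixSemigroup P)} (hA : ∀ i g l, elem i g l ∈ Subsemigroup.closure A) (i : I) :
    ∃ x m, elem i x m ∈ A ∧ m ∉ Λ' := by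
  obtain ⟨k⟩ := hP.nonempty_index hne
  obtain ⟨j, -, l, -, hl⟩ := hP.exists_ne_zero k
  -- The first factor of a product keeps its column. Its row is that of the product if it is the
  -- only factor, and otherwise the row of a non-zero entry.
  obtain ⟨x, m, hm, h⟩ := closure_elem_induction
    (p := fun i _ l => ∃ x m, elem i x m ∈ A ∧ (m = l ∨ m ∉ Λ'))
    (fun i g l h => ⟨g, l, h, Or.inl rfl⟩)
    (by
      rintro i g l j h m x hx ⟨y, q, hq, hql⟩ -
      refine ⟨y, q, hq, Or.inr ?_⟩
      rcases hql with rfl | hql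
      · exact (hP.notMem_of_ne_zero (by rw [hx]; exact WithZero.coe_ne_zero)).2
      · exact hql) (hA i 1 l)
  refine ⟨x, m, hm, ?_⟩
  rcases h with rfl | h
  · exact (hP.notMem_of_ne_zero hl).2
  · exact h

/-- A generating set contains an element in every row, with a non-zero column. -/
theorem exists_generator_row (hP : IsGrahamNormalForm P I' Λ' Ib Λb) (hne : P ≠ 0)
    {A : Set (ReesMatrixSemigroup P)} (hA : ∀ i g l, elem i g l ∈ Subsemigroup.closure A) (l : Λ) :
    ∃ j x, elem j x l ∈ A ∧ j ∉ I' := by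
  obtain ⟨k⟩ := hP.nonempty_index hne
  obtain ⟨i, -, l₀, -, hl⟩ := hP.exists_ne_zero k
  obtain ⟨j, x, hm, h⟩ := closure_elem_induction
    (p := fun i _ l => ∃ j x, elem j x l ∈ A ∧ (j = i ∨ j ∉ I'))
    (fun i g l h => ⟨i, g, h, Or.inl rfl⟩)
    (by
      rintro i g l j h m x hx - ⟨q, y, hq, hql⟩
      refine ⟨q, y, hq, Or.inr ?_⟩
      rcases hql with rfl | hql
      · exact (hP.notMem_of_ne_zero (by rw [hx]; exact WithZero.coe_ne_zero)).1
      · exact hql) (hA i 1 l)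
  refine ⟨j, x, hm, ?_⟩
  rcases h with rfl | h
  · exact (hP.notMem_of_ne_zero hl).1
  · exact h

/-- The generators found for zero columns have non-zero rows, and those for zero rows have non-zero
columns, so these two families and the core are disjoint. -/
theorem card_corePart_add_le [Finite I] [Finite Λ] (hP : IsGrahamNormalForm P I' Λ' Ib Λb)
    (hne : P ≠ 0) {A : Finset (ReesMatrixSemigroup P)}
    (hA : ∀ i g l, elem i g l ∈ Subsemigroup.closure (A : Set (ReesMatrixSemigroup P))) :
    (corePart I' Λ' A).card + I'.ncard + Λ'.ncard ≤ A.card := by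
  classical
  choose x m hxm hm using hP.exists_generator_col hne hA
  choose j y hjy hj using hP.exists_generator_row hne hA
  let u : I → ReesMatrixSemigroup P := fun i => elem i (x i) (m i)
  let w : Λ → ReesMatrixSemigroup P := fun l => elem (j l) (y l) l
  have hu : Function.Injective u := fun a b h => by injection h
  have hw : Function.Injective w := fun a b h => by injection h
  rw [← Set.ncard_coe_finset, ← Set.ncard_coe_finset A, ← Set.ncard_image_of_injective I' hu,
    ← Set.ncard_image_of_injective Λ' hw, ← Set.ncard_union_eq, ← Set.ncard_union_eq]
  · refine Set.ncard_le_ncard ?_ A.finite_toSet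
    rintro s ((hs | ⟨i, -, rfl⟩) | ⟨l, -, rfl⟩)
    · exact (Finset.mem_filter.1 hs).1
    · exact hxm i
    · exact hjy l
  · rw [Set.disjoint_left]
    rintro _ (hs | ⟨i, hi, rfl⟩) ⟨l, hl, e⟩
    · subst e
      exact (elem_mem_corePart.1 hs).2.2 hl
    · have e₁ : j l = i := by injection e
      exact hj l (e₁ ▸ hi)
  · rw [Set.disjoint_left]
    rintro _ hs ⟨i, hi, rfl⟩
    exact (elem_mem_corePart.1 hs).2.1 hi

theorem ncard_cols_le_card_corePart (hP : IsGrahamNormalForm P I' Λ' Ib Λb)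
    (hne : P ≠ 0) {A : Finset (ReesMatrixSemigroup P)}
    (hA : ∀ i g l, elem i g l ∈ Subsemigroup.closure (A : Set (ReesMatrixSemigroup P))) :
    I'ᶜ.ncard ≤ (corePart I' Λ' A).card := by
  choose x m hxm hm using hP.exists_generator_col hne hA
  rw [← Set.ncard_coe_finset]
  exact Set.ncard_le_ncard_of_injOn (fun i => elem i (x i) (m i))
    (fun i hi => elem_mem_corePart.2 ⟨hxm i, hi, hm i⟩) (fun a _ b _ h => by injection h)
    (Finset.finite_toSet _)

theorem ncard_rows_le_card_corePart (hP : IsGrahamNormalForm P I' Λ' Ib Λb)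
    (hne : P ≠ 0) {A : Finset (ReesMatrixSemigroup P)}
    (hA : ∀ i g l, elem i g l ∈ Subsemigroup.closure (A : Set (ReesMatrixSemigroup P))) :
    Λ'ᶜ.ncard ≤ (corePart I' Λ' A).card := by
  choose j y hjy hj using hP.exists_generator_row hne hA
  rw [← Set.ncard_coe_finset]
  exact Set.ncard_le_ncard_of_injOn (fun l => elem (j l) (y l) l)
    (fun l hl => elem_mem_corePart.2 ⟨hjy l, hj l, hl⟩) (fun a _ b _ h => by injection h)
    (Finset.finite_toSet _)

theorem sigmaMin_add_le_card_corePart (hP : IsGrahamNormalForm P I' Λ' Ib Λb)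
    (hne : P ≠ 0) {A : Finset (ReesMatrixSemigroup P)}
    (hA : ∀ i g l, elem i g l ∈ Subsemigroup.closure (A : Set (ReesMatrixSemigroup P))) :
    sigmaMin (fun k => entrySubgroup (matrixBlock P (Λb k) (Ib k))) + n - 1 ≤
      (corePart I' Λ' A).card := by
  classical
  have hn := hP.nonempty_index hne
  obtain ⟨c, d, hc, hd⟩ := hP.exists_component hne
  have k₀ : Fin n := hn.some
  have hcd : ∀ {l i} {x : G}, P l i = x → i ∉ I' ∧ l ∉ Λ' ∧ c i = d l := by
    intro l i x hx
    obtain ⟨k, hl, hi⟩ := hP.exists_block (by rw [hx]; exact WithZero.coe_ne_zero)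
    rw [hc] at hi
    rw [hd] at hl
    exact ⟨hi.1, hl.1, hi.2.trans hl.2.symm⟩
  -- The values at `zero` are irrelevant, since `corePart` never contains it.
  let s : ReesMatrixSemigroup P → Fin n
    | .zero => k₀
    | .elem i _ _ => c i
  let t : ReesMatrixSemigroup P → Fin n
    | .zero => k₀
    | .elem _ _ l => d l
  let lab : ReesMatrixSemigroup P → G
    | .zero => 1
    | .elem _ g _ => g
  -- If no core generator left `V`, no product starting in `V` would: non-zero entries stay within a
  -- block.
  obtain ⟨T, hTB, hT, hpot, -⟩ := exists_spanning_arrows (G := G) (corePart I' Λ' A) s t (by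
    intro V hV hVu
    by_contra! hcon
    obtain ⟨k, hk⟩ := hV
    obtain ⟨k', hk'⟩ : ∃ k', k' ∉ V := by
      by_contra! h
      exact hVu (Finset.eq_univ_iff_forall.2 h)
    obtain ⟨i, hi, -⟩ := hP.exists_ne_zero k
    obtain ⟨-, -, l, hl, -⟩ := hP.exists_ne_zero k'
    rw [hc] at hi
    rw [hd] at hl
    have := closure_elem_induction
      (p := fun i _ l => i ∉ I' → l ∉ Λ' → c i ∈ V → d l ∈ V)
      (fun i g l h hi hl => hcon _ (elem_mem_corePart.2 ⟨h, hi, hl⟩))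
      (by
        intro i g l j h m x hx ih₁ ih₂ hi hm hiV
        obtain ⟨hj, hl, e⟩ := hcd hx
        exact ih₂ hj hm (e ▸ ih₁ hi hl hiV)) (hA i 1 l) hi.1 hl.1 (hi.2 ▸ hk)
    exact hk' (hl.2 ▸ this))
  obtain ⟨θ, hθ⟩ := hpot lab
  let X : Finset G := ((corePart I' Λ' A) \ T).image fun a => θ (s a) * lab a * (θ (t a))⁻¹
  set Y : Set G := ⋃ k, (fun h => θ k * h * (θ k)⁻¹) ''
    (entrySubgroup (matrixBlock P (Λb k) (Ib k)) : Set G)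
  have htop : Subsemigroup.closure (Y ∪ (X : Set G)) = ⊤ := by
    rw [eq_top_iff]
    rintro z -
    obtain ⟨i, hi, l, hl, -⟩ := hP.exists_ne_zero k₀
    rw [hc] at hi
    rw [hd] at hl
    have := closure_elem_induction
      (p := fun i g l => i ∉ I' → l ∉ Λ' →
        θ (c i) * g * (θ (d l))⁻¹ ∈ Subsemigroup.closure (Y ∪ (X : Set G)))
      (by
        intro i g l h hi hl
        refine Subsemigroup.subset_closure ?_
        have hB := elem_mem_corePart.2 ⟨h, hi, hl⟩
        by_cases hmem : elem i g l ∈ T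
        -- Tree arrows have normalized label `1`, already in `Y`, so they need no element of `X`.
        · refine Or.inl (Set.mem_iUnion.2 ⟨k₀, 1, one_mem _, ?_⟩)
          have := hθ _ hmem
          simp only [s, t, lab] at this
          simp [this]
        · exact Or.inr (Finset.mem_image.2 ⟨_, Finset.mem_sdiff.2 ⟨hB, hmem⟩, rfl⟩))
      (by
        intro i g l j h m x hx ih₁ ih₂ hi hm
        obtain ⟨hj, hl, e⟩ := hcd hx
        have hxY : θ (d l) * x * (θ (d l))⁻¹ ∈ Subsemigroup.closure (Y ∪ (X : Set G)) :=
          Subsemigroup.subset_closure (Or.inl (Set.mem_iUnion.2 ⟨d l, x,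
            Subgroup.subset_closure ⟨⟨l, (hd _ _).2 ⟨hl, rfl⟩⟩, ⟨j, (hc _ _).2 ⟨hj, e⟩⟩, hx⟩, rfl⟩))
        have := mul_mem (mul_mem (ih₁ hi hl) hxY) (ih₂ hj hm)
        rw [e] at this
        convert this using 1
        -- Column `i` and row `l` both lie in block `k₀`, so this element has normalized label `z`.
        group) (hA i ((θ k₀)⁻¹ * z * θ k₀) l) hi.1 hl.1
    rw [hi.2, hl.2] at this
    convert this using 1
    group
  have hσ : sigmaMin (fun k => entrySubgroup (matrixBlock P (Λb k) (Ib k))) ≤ X.card :=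
    (Nat.sInf_le (Set.mem_range_self θ)).trans
      (show relativeRank G Y ≤ X.card from Nat.sInf_le ⟨X, rfl, htop⟩)
  have hX : X.card ≤ ((corePart I' Λ' A) \ T).card := Finset.card_image_le
  have := Finset.card_sdiff_add_card_eq_card hTB
  rw [Fintype.card_fin] at hT
  omega

end IsGrahamNormalForm

end LowerBound

/-! ### The upper bound -/

/-- Elements of a finite set of group elements can be placed as values outside of a set `T` of
indices on which the value is `1`. -/
theorem exists_extension_of_card_add_le {G : Type*} [Group G] {r : ℕ} (T : Finset (Fin r))
    (X : Finset G) (h : X.card + T.card ≤ r) :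
    ∃ y : Fin r → G, (∀ a ∈ T, y a = 1) ∧ ∀ x ∈ X, ∃ a, y a = x := by
  classical
  have hcard : Fintype.card X ≤ Fintype.card (Tᶜ : Finset (Fin r)) := by
    rw [Fintype.card_coe, Fintype.card_coe, Finset.card_compl, Fintype.card_fin]
    omega
  obtain ⟨e⟩ := Function.Embedding.nonempty_of_card_le hcard
  have he : Function.Injective fun x : X => (e x : Fin r) :=
    Subtype.val_injective.comp e.injective
  refine ⟨Function.extend (fun x : X => (e x : Fin r)) Subtype.val 1, ?_, ?_⟩
  · intro a ha
    rw [Function.extend_apply', Pi.one_apply]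
    rintro ⟨x, rfl⟩
    exact Finset.mem_compl.1 (e x).2 ha
  · intro x hx
    exact ⟨e ⟨x, hx⟩, he.extend_apply _ _ (⟨x, hx⟩ : X)⟩

theorem exists_range_eq_of_ncard_le {α : Type*} [Finite α] {s : Set α} (hs : s.Nonempty) {r : ℕ}
    (h : s.ncard ≤ r) : ∃ f : Fin r → α, Set.range f = s := by
  classical
  have := hs.to_subtype
  have := Fintype.ofFinite s
  have hcard : Fintype.card s ≤ Fintype.card (Fin r) := by
    rwa [Fintype.card_fin, ← Nat.card_eq_fintype_card, Nat.card_coe_set_eq]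
  obtain ⟨e⟩ := Function.Embedding.nonempty_of_card_le hcard
  refine ⟨fun a => ((Function.invFun e a : s) : α), ?_⟩
  change Set.range (Subtype.val ∘ Function.invFun e) = s
  rw [Set.range_comp, (Function.invFun_surjective e.injective).range_eq,
    Set.image_univ, Subtype.range_coe]

/-- If all pairs of vertices of `C` are joined by walks whose label is the coboundary of `θ`, then
the normalized labels of walks between vertices of `C` form a subgroup of a finite group. -/
theorem exists_subgroup_labelledWalk {V G : Type*} [Group G] [Finite G] {E : V → G → V → Prop}
    {C : Set V} (hC : C.Nonempty) (θ : V → G)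
    (h : ∀ u ∈ C, ∀ v ∈ C, LabelledWalk E u ((θ u)⁻¹ * θ v) v) :
    ∃ K : Subgroup G, ∀ z, z ∈ K ↔ ∃ u ∈ C, ∃ v ∈ C, LabelledWalk E u ((θ u)⁻¹ * z * θ v) v := by
  -- Composing with walks of trivial normalized label at both ends moves the endpoints freely.
  have hall : ∀ z, (∃ u ∈ C, ∃ v ∈ C, LabelledWalk E u ((θ u)⁻¹ * z * θ v) v) →
      ∀ u ∈ C, ∀ v ∈ C, LabelledWalk E u ((θ u)⁻¹ * z * θ v) v := by
    rintro z ⟨u, hu, v, hv, huv⟩ u' hu' v' hv'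
    have := ((h u' hu' u hu).trans huv).trans (h v hv v' hv')
    convert this using 1
    group
  obtain ⟨u₀, hu₀⟩ := hC
  refine ⟨{ carrier := {z | ∃ u ∈ C, ∃ v ∈ C, LabelledWalk E u ((θ u)⁻¹ * z * θ v) v}
            one_mem' := ⟨u₀, hu₀, u₀, hu₀, by simpa using LabelledWalk.refl (E := E) u₀⟩
            mul_mem' := ?_
            inv_mem' := ?_ }, fun z => Iff.rfl⟩
  · intro a b ha hb
    refine ⟨u₀, hu₀, u₀, hu₀, ?_⟩
    convert (hall a ha u₀ hu₀ u₀ hu₀).trans (hall b hb u₀ hu₀ u₀ hu₀) using 1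
    group
  · intro a ha
    refine ⟨u₀, hu₀, u₀, hu₀, ?_⟩
    have := hall a ha u₀ hu₀ u₀ hu₀
    convert this.inv this using 1
    group

section UpperBound

open ReesMatrixSemigroup Relation

variable {G I Λ : Type*} [Group G] {P : Matrix Λ I (WithZero G)}

/-- The labelled digraph on `I ⊔ Λ` with an edge `i → l` labelled `g` for each `(i, g, l) ∈ A`, and
an edge `l → i` labelled `P l i` for each non-zero entry of `P`. -/
inductive ReesEdge (A : Set (ReesMatrixSemigroup P)) : I ⊕ Λ → G → I ⊕ Λ → Prop
  | gen {i : I} {g : G} {l : Λ} : elem i g l ∈ A → ReesEdge A (.inl i) g (.inr l)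
  | entry {l : Λ} {p : G} {i : I} : P l i = p → ReesEdge A (.inr l) p (.inl i)

theorem elem_mem_closure_of_labelledWalk {A : Set (ReesMatrixSemigroup P)} {i : I} {g : G} {l : Λ}
    (h : LabelledWalk (ReesEdge A) (.inl i) g (.inr l)) :
    elem i g l ∈ Subsemigroup.closure A := by
  -- At a column vertex the walk is empty or ends with an entry still waiting for its right factor.
  let motive : G → I ⊕ Λ → Prop := fun g v => match v with
    | .inr l => elem i g l ∈ Subsemigroup.closure A
    | .inl j => (g = 1 ∧ j = i) ∨
        ∃ l g' p, elem i g' l ∈ Subsemigroup.closure A ∧ P l j = ((p : G) : WithZero G) ∧ g = g' * p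
  have key : ∀ u g v, LabelledWalk (ReesEdge A) u g v → u = .inl i → motive g v := by
    intro u g v h hu
    induction h with
    | refl => subst hu; exact Or.inl ⟨rfl, rfl⟩
    | tail _ he ih =>
      cases he with
      | gen ha =>
        have ha' := Subsemigroup.subset_closure ha
        rcases ih with ⟨rfl, rfl⟩ | ⟨l, g', p, hl, hp, rfl⟩
        · simpa [motive] using ha'
        · simpa only [elem_mul_elem hp] using mul_mem hl ha'
      | entry hp => exact Or.inr ⟨_, _, _, ih, hp, rfl⟩
  exact key _ _ _ h rfl

/-- Enough generators in the non-zero rows and columns can be positioned so that the labelled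
digraph they define is strongly connected, for any choice of the group elements. -/
theorem exists_strongly_connected_positions [Finite I] [Finite Λ] {C : Set I} {D : Set Λ}
    (hC : C.Nonempty) (hD : D.Nonempty) (hrow : ∀ l ∈ D, ∃ i ∈ C, P l i ≠ 0)
    (hcol : ∀ i ∈ C, ∃ l ∈ D, P l i ≠ 0) {r : ℕ} (hCr : C.ncard ≤ r) (hDr : D.ncard ≤ r) :
    ∃ (f : Fin r → I) (h : Fin r → Λ), Set.range f = C ∧ Set.range h = D ∧
      ∀ x : Fin r → G, ∀ u, Sum.elim (· ∈ C) (· ∈ D) u → ∀ v, Sum.elim (· ∈ C) (· ∈ D) v →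
        ∃ g, LabelledWalk
          (ReesEdge (Set.range fun a => (elem (f a) (x a) (h a) : ReesMatrixSemigroup P))) u g v := by
  obtain ⟨f, hf⟩ := exists_range_eq_of_ncard_le hC hCr
  obtain ⟨h, hh⟩ := exists_range_eq_of_ncard_le hD hDr
  have hfC : ∀ a, f a ∈ C := fun a => hf ▸ Set.mem_range_self a
  have hhD : ∀ a, h a ∈ D := fun a => hh ▸ Set.mem_range_self a
  -- Here `a → b` means that generator `a` may be followed by generator `b`. Permuting
  -- out-neighbourhoods replaces `h` by `h ∘ π`, which re-pairs rows with columns.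
  obtain ⟨π, hπ⟩ := exists_perm_transGen (Q := fun a b => P (h a) (f b) ≠ 0)
    (fun a => by
      obtain ⟨i, hi, hne⟩ := hrow _ (hhD a)
      obtain ⟨b, rfl⟩ := hf.symm.subset hi
      exact ⟨b, hne⟩)
    (fun b => by
      obtain ⟨l, hl, hne⟩ := hcol _ (hfC b)
      obtain ⟨a, rfl⟩ := hh.symm.subset hl
      exact ⟨a, hne⟩)
  refine ⟨f, h ∘ π, hf, by rw [Set.range_comp, π.range_eq_univ, Set.image_univ, hh], fun x => ?_⟩
  set E := ReesEdge (Set.range fun a => (elem (f a) (x a) ((h ∘ π) a) : ReesMatrixSemigroup P))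
  have hgen : ∀ a, E (.inl (f a)) (x a) (.inr (h (π a))) := fun a => .gen ⟨a, rfl⟩
  have hentry : ∀ {l i}, P l i ≠ 0 → ∃ p, E (.inr l) p (.inl i) := by
    intro l i hne
    obtain ⟨p, hp⟩ := WithZero.ne_zero_iff_exists.1 hne
    exact ⟨p, .entry hp.symm⟩
  have hff : ∀ a b, ∃ g, LabelledWalk E (.inl (f a)) g (.inl (f b)) := by
    intro a b
    induction hπ a b with
    | single he =>
      obtain ⟨p, hp⟩ := hentry he
      exact ⟨_, (LabelledWalk.single (hgen a)).tail hp⟩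
    | tail _ he ih =>
      obtain ⟨g, hg⟩ := ih
      obtain ⟨p, hp⟩ := hentry he
      exact ⟨_, (hg.tail (hgen _)).tail hp⟩
  have hfrom : ∀ u, Sum.elim (· ∈ C) (· ∈ D) u → ∃ a g, LabelledWalk E u g (.inl (f a)) := by
    rintro (i | l) hu
    · obtain ⟨a, rfl⟩ := hf.symm.subset hu
      exact ⟨a, 1, .refl _⟩
    · obtain ⟨i, hi, hne⟩ := hrow l hu
      obtain ⟨a, rfl⟩ := hf.symm.subset hi
      obtain ⟨p, hp⟩ := hentry hne
      exact ⟨a, p, .single hp⟩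
  have hto : ∀ v, Sum.elim (· ∈ C) (· ∈ D) v → ∃ a g, LabelledWalk E (.inl (f a)) g v := by
    rintro (i | l) hv
    · obtain ⟨a, rfl⟩ := hf.symm.subset hv
      exact ⟨a, 1, .refl _⟩
    · obtain ⟨a, rfl⟩ := hh.symm.subset hv
      refine ⟨π.symm a, _, .single (by simpa using hgen (π.symm a))⟩
  intro u hu v hv
  obtain ⟨a, g₁, h₁⟩ := hfrom u hu
  obtain ⟨b, g₃, h₃⟩ := hto v hv
  obtain ⟨g₂, h₂⟩ := hff a b
  exact ⟨_, (h₁.trans h₂).trans h₃⟩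

end UpperBound

theorem exists_finset_card_eq_relativeRank {G : Type*} [Semigroup G] [Finite G] (A : Set G) :
    ∃ X : Finset G, X.card = relativeRank G A ∧ Subsemigroup.closure (A ∪ (X : Set G)) = ⊤ := by
  have := Fintype.ofFinite G
  refine Nat.sInf_mem (s := {m : ℕ | ∃ X : Finset G, X.card = m ∧
    Subsemigroup.closure (A ∪ (X : Set G)) = ⊤}) ⟨_, Finset.univ, rfl, ?_⟩
  simp

theorem exists_relativeRank_eq_sigmaMin {G : Type*} [Group G] {n : ℕ} (H : Fin n → Subgroup G) :
    ∃ g : Fin n → G, relativeRank G (⋃ k, (fun h => g k * h * (g k)⁻¹) '' (H k : Set G)) =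
      sigmaMin H :=
  Nat.sInf_mem (Set.range_nonempty _)

namespace IsGrahamNormalForm

open ReesMatrixSemigroup

variable {G I Λ : Type*} [Group G] [Finite G] [Finite I] [Finite Λ]
  {P : Matrix Λ I (WithZero G)} {I' : Set I} {Λ' : Set Λ}
  {n : ℕ} {Ib : Fin n → Set I} {Λb : Fin n → Set Λ}

theorem exists_core_generators (hP : IsGrahamNormalForm P I' Λ' Ib Λb) (hne : P ≠ 0) {r : ℕ}
    (hI : I'ᶜ.ncard ≤ r) (hΛ : Λ'ᶜ.ncard ≤ r)
    (hσ : sigmaMin (fun k => entrySubgroup (matrixBlock P (Λb k) (Ib k))) + n - 1 ≤ r) :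
    ∃ B : Finset (ReesMatrixSemigroup P), B.card ≤ r ∧ ∀ i ∉ I', ∀ g, ∀ l ∉ Λ',
      elem i g l ∈ Subsemigroup.closure (B : Set (ReesMatrixSemigroup P)) := by
  classical
  have hn := hP.nonempty_index hne
  obtain ⟨c, d, hc, hd⟩ := hP.exists_component hne
  have hcd : ∀ {l i}, P l i ≠ 0 → i ∉ I' ∧ l ∉ Λ' ∧ c i = d l := by
    intro l i hx
    obtain ⟨k, hl, hi⟩ := hP.exists_block hx
    rw [hc] at hi
    rw [hd] at hl
    exact ⟨hi.1, hl.1, hi.2.trans hl.2.symm⟩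
  obtain ⟨i₀, hi₀, l₀, hl₀, h₀⟩ := hP.exists_ne_zero hn.some
  obtain ⟨f, h, hf, hh, hSC⟩ := exists_strongly_connected_positions (P := P) (C := I'ᶜ) (D := Λ'ᶜ)
    ⟨i₀, (hcd h₀).1⟩ ⟨l₀, (hcd h₀).2.1⟩
    (fun l hl => by
      obtain ⟨i, hi⟩ := (hP.regular_block (d l)).1 ⟨l, (hd _ _).2 ⟨hl, rfl⟩⟩
      exact ⟨i, ((hc _ _).1 i.2).1, hi⟩)
    (fun i hi => by
      obtain ⟨l, hl⟩ := (hP.regular_block (c i)).2 ⟨i, (hc _ _).2 ⟨hi, rfl⟩⟩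
      exact ⟨l, ((hd _ _).1 l.2).1, hl⟩) hI hΛ
  let C : Set (I ⊕ Λ) := {u | Sum.elim (· ∈ I'ᶜ) (· ∈ Λ'ᶜ) u}
  let comp : I ⊕ Λ → Fin n := Sum.elim c d
  have hfC : ∀ a, Sum.inl (f a) ∈ C := fun a => hf.subset (Set.mem_range_self a)
  have hhC : ∀ a, Sum.inr (h a) ∈ C := fun a => hh.subset (Set.mem_range_self a)
  have hcompC : ∀ k, ∃ u ∈ C, comp u = k := by
    intro k
    obtain ⟨i, hi, -⟩ := hP.exists_ne_zero k
    rw [hc] at hi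
    exact ⟨.inl i, hi.1, hi.2⟩
  -- Walks change block only along generators, so strong connectivity gives an arrow out of every
  -- proper set of blocks. Labels play no role, hence the label function `1`.
  obtain ⟨T, -, hTcard, -, hTconn⟩ := exists_spanning_arrows (G := G) Finset.univ
    (fun a => c (f a)) (fun a => d (h a)) (by
      intro V hV hVu
      by_contra! hcon
      obtain ⟨k, hk⟩ := hV
      obtain ⟨k', hk'⟩ : ∃ k', k' ∉ V := by
        by_contra! h
        exact hVu (Finset.eq_univ_iff_forall.2 h)
      obtain ⟨u, hu, rfl⟩ := hcompC k
      obtain ⟨v, hv, rfl⟩ := hcompC k'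
      obtain ⟨g, hg⟩ := hSC 1 u hu v hv
      refine hk' ?_
      clear hk' hv
      induction hg with
      | refl => exact hk
      | tail _ he ih =>
        cases he with
        | gen ha =>
          obtain ⟨a, ha⟩ := ha
          cases ha
          exact hcon a (Finset.mem_univ _) ih
        | entry hp =>
          have := (hcd (by rw [hp]; exact WithZero.coe_ne_zero)).2.2
          simpa [comp, this] using ih)
  rw [Fintype.card_fin] at hTcard
  obtain ⟨θ, hθ⟩ := exists_relativeRank_eq_sigmaMin
    fun k => entrySubgroup (matrixBlock P (Λb k) (Ib k))
  obtain ⟨X, hX, hXtop⟩ := exists_finset_card_eq_relativeRank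
    (⋃ k, (fun x => θ k * x * (θ k)⁻¹) ''
      (entrySubgroup (matrixBlock P (Λb k) (Ib k)) : Set G))
  obtain ⟨y, hyT, hyX⟩ := exists_extension_of_card_add_le T X (by omega)
  -- Chosen so that the label normalized by `θ` is `y a`, which is `1` on the tree.
  let x : Fin r → G := fun a => (θ (c (f a)))⁻¹ * y a * θ (d (h a))
  let elt : Fin r → ReesMatrixSemigroup P := fun a => elem (f a) (x a) (h a)
  let E := ReesEdge (Set.range elt)
  have hSC : ∀ u ∈ C, ∀ v ∈ C, ∃ g, LabelledWalk E u g v := hSC x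
  let ψ : I ⊕ Λ → G := fun u => θ (comp u)
  -- Being joined by walks of trivial normalized label in both directions; on `C` one direction
  -- suffices, by inverting walks.
  let ρ : Setoid (I ⊕ Λ) :=
    { r := fun u v => LabelledWalk E u ((ψ u)⁻¹ * ψ v) v ∧ LabelledWalk E v ((ψ v)⁻¹ * ψ u) u
      iseqv := ⟨fun u => by simpa using LabelledWalk.refl (E := E) u, fun h => h.symm,
        fun h h' => ⟨by simpa [mul_assoc] using h.1.trans h'.1,
          by simpa [mul_assoc] using h'.2.trans h.2⟩⟩ }
  have hρ : ∀ u ∈ C, ∀ v ∈ C, LabelledWalk E u ((ψ u)⁻¹ * ψ v) v → ρ u v := by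
    intro u hu v hv huv
    obtain ⟨q, hq⟩ := hSC v hv u hu
    exact ⟨huv, by simpa using huv.inv hq⟩
  have hblock : ∀ u ∈ C, ∀ v ∈ C, comp u = comp v → ρ u v := by
    have hlift : ∀ k, ∀ u ∈ C, comp u = k →
        ∃ w : Ib k ⊕ Λb k, Sum.map Subtype.val Subtype.val w = u := by
      rintro k (i | l) hu huk
      · exact ⟨.inl ⟨i, (hc _ _).2 ⟨hu, huk⟩⟩, rfl⟩
      · exact ⟨.inr ⟨l, (hd _ _).2 ⟨hu, huk⟩⟩, rfl⟩
    intro u hu v hv huv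
    obtain ⟨k, hk⟩ : ∃ k, comp v = k := ⟨_, rfl⟩
    obtain ⟨u', rfl⟩ := hlift k u hu (huv.trans hk)
    obtain ⟨v', rfl⟩ := hlift k v hv hk
    refine hP.setoid_rel_of_block ρ ?_ _ u' v'
    intro i l hp
    obtain ⟨hi, hl, e⟩ := hcd (by rw [hp]; exact WithZero.coe_ne_zero)
    refine ρ.symm (hρ _ hl _ hi ?_)
    -- The potential is constant on a block, so an entry `1` has trivial normalized label.
    have : (ψ (.inr l))⁻¹ * ψ (.inl i) = 1 := by simp [ψ, comp, e]
    rw [this]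
    exact .single (.entry hp)
  have hρall : ∀ u ∈ C, ∀ v ∈ C, ρ u v := by
    -- Blocks are related when all their core vertices are; the tree arrows then relate all blocks.
    let τ : Setoid (Fin n) :=
      { r := fun k k' => ∀ u ∈ C, ∀ v ∈ C, comp u = k → comp v = k' → ρ u v
        iseqv :=
          ⟨fun k u hu v hv huk hvk => hblock u hu v hv (huk.trans hvk.symm),
            fun h u hu v hv huk hvk => ρ.symm (h v hv u hu hvk huk),
            fun {k k' k''} h h' u hu v hv huk hvk => by
              obtain ⟨w, hw, hwk⟩ := hcompC k'
              exact ρ.trans (h u hu w hw huk hwk) (h' w hw v hv hwk hvk)⟩ }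
    intro u hu v hv
    refine hTconn τ ?_ _ _ u hu v hv rfl rfl
    intro a ha u hu v hv huk hvk
    refine ρ.trans (hblock u hu _ (hfC a) huk) (ρ.trans (hρ _ (hfC a) _ (hhC a) (.single ?_))
      (hblock _ (hhC a) v hv hvk.symm))
    have hx : x a = (ψ (.inl (f a)))⁻¹ * ψ (.inr (h a)) := by simp [x, ψ, comp, hyT a ha]
    exact hx ▸ .gen ⟨a, rfl⟩
  obtain ⟨K, hK⟩ := exists_subgroup_labelledWalk ⟨.inl i₀, (hcd h₀).1⟩ ψ
    fun u hu v hv => (hρall u hu v hv).1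
  have hKtop : ∀ z, z ∈ K := by
    have hle : Subsemigroup.closure ((⋃ k, (fun x => θ k * x * (θ k)⁻¹) ''
        (entrySubgroup (matrixBlock P (Λb k) (Ib k)) : Set G)) ∪ (X : Set G)) ≤
        K.toSubmonoid.toSubsemigroup := by
      rw [Subsemigroup.closure_le]
      rintro z (hz | hz)
      · obtain ⟨k, p, hp, rfl⟩ := Set.mem_iUnion.1 hz
        have hHK : entrySubgroup (matrixBlock P (Λb k) (Ib k)) ≤
            K.comap (MulAut.conj (θ k)).toMonoidHom := by
          rw [entrySubgroup, Subgroup.closure_le]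
          rintro p ⟨l, i, hp⟩
          have hl := (hd _ _).1 l.2
          have hi := (hc _ _).1 i.2
          refine (hK _).2 ⟨.inr l, hl.1, .inl i, hi.1, .single ?_⟩
          have : (ψ (.inr l))⁻¹ * (MulAut.conj (θ k)).toMonoidHom p * ψ (.inl i) = p := by
            simp [ψ, comp, hl.2, hi.2, mul_assoc]
          rw [this]
          exact .entry hp
        exact hHK hp
      · obtain ⟨a, rfl⟩ := hyX z hz
        exact (hK _).2 ⟨_, hfC a, _, hhC a, .single (.gen ⟨a, rfl⟩)⟩
    rw [hXtop] at hle
    exact fun z => hle (Subsemigroup.mem_top z)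
  refine ⟨Finset.univ.image elt, Finset.card_image_le.trans (by simp), fun i hi g l hl => ?_⟩
  rw [Finset.coe_image, Finset.coe_univ, Set.image_univ]
  apply elem_mem_closure_of_labelledWalk
  obtain ⟨u, hu, v, hv, huv⟩ := (hK _).1 (hKtop (ψ (.inl i) * g * (ψ (.inr l))⁻¹))
  have := ((hρall (.inl i) hi u hu).1.trans huv).trans (hρall v hv (.inr l) hl).1
  convert this using 1
  group

/-- One non-zero entry `p` at `(m, j)` suffices to attach everything else: `(i, 1, m)` for each zero
column and `(j, 1, l)` for each zero row, with `p⁻¹` absorbed into the other factor. -/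
theorem exists_generators (hP : IsGrahamNormalForm P I' Λ' Ib Λb) (hne : P ≠ 0) {r : ℕ}
    (hI : I'ᶜ.ncard ≤ r) (hΛ : Λ'ᶜ.ncard ≤ r)
    (hσ : sigmaMin (fun k => entrySubgroup (matrixBlock P (Λb k) (Ib k))) + n - 1 ≤ r) :
    ∃ A : Finset (ReesMatrixSemigroup P), A.card ≤ r + I'.ncard + Λ'.ncard ∧ ∀ i g l,
      elem i g l ∈ Subsemigroup.closure (A : Set (ReesMatrixSemigroup P)) := by
  classical
  obtain ⟨B, hB, hBgen⟩ := hP.exists_core_generators hne hI hΛ hσ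
  obtain ⟨k⟩ := hP.nonempty_index hne
  obtain ⟨j, -, m, -, hmj⟩ := hP.exists_ne_zero k
  obtain ⟨hj, hm⟩ := hP.notMem_of_ne_zero hmj
  obtain ⟨p, hp⟩ := WithZero.ne_zero_iff_exists.1 hmj
  have hI' := I'.toFinite
  have hΛ' := Λ'.toFinite
  let U : Finset (ReesMatrixSemigroup P) := hI'.toFinset.image fun i => elem i 1 m
  let W : Finset (ReesMatrixSemigroup P) := hΛ'.toFinset.image fun l => elem j 1 l
  refine ⟨B ∪ U ∪ W, ?_, ?_⟩
  · have hU : U.card ≤ I'.ncard := by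
      rw [Set.ncard_eq_toFinset_card I' hI']; exact Finset.card_image_le
    have hW : W.card ≤ Λ'.ncard := by
      rw [Set.ncard_eq_toFinset_card Λ' hΛ']; exact Finset.card_image_le
    have h₁ := Finset.card_union_le (B ∪ U) W
    have h₂ := Finset.card_union_le B U
    omega
  · set M := Subsemigroup.closure ((B ∪ U ∪ W : Finset _) : Set (ReesMatrixSemigroup P))
    have hcore : ∀ i ∉ I', ∀ g, ∀ l ∉ Λ', elem i g l ∈ M := fun i hi g l hl =>
      Subsemigroup.closure_mono (by
        intro s hs
        simp only [Finset.coe_union]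
        exact Or.inl (Or.inl hs)) (hBgen i hi g l hl)
    have hcol : ∀ i ∉ I', ∀ g l, elem i g l ∈ M := by
      intro i hi g l
      by_cases hl : l ∈ Λ'
      · have hw : elem j 1 l ∈ M := Subsemigroup.subset_closure
          (Finset.mem_coe.2 (Finset.mem_union_right _
            (Finset.mem_image.2 ⟨l, hΛ'.mem_toFinset.2 hl, rfl⟩)))
        have := mul_mem (hcore i hi (g * p⁻¹) m hm) hw
        rw [elem_mul_elem hp.symm] at this
        simpa using this
      · exact hcore i hi g l hl
    intro i g l
    by_cases hi : i ∈ I'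
    · have hu : elem i 1 m ∈ M := Subsemigroup.subset_closure
        (Finset.mem_coe.2 (Finset.mem_union_left _ (Finset.mem_union_right _
          (Finset.mem_image.2 ⟨i, hI'.mem_toFinset.2 hi, rfl⟩))))
      have := mul_mem hu (hcol j hj (p⁻¹ * g) l)
      rw [elem_mul_elem hp.symm] at this
      simpa using this
    · exact hcol i hi g l

end IsGrahamNormalForm

theorem theorem2p5 {G I Λ : Type*} [Group G] [Finite G] [Finite I] [Finite Λ]
    (P : Matrix Λ I (WithZero G)) (I' : Set I) (Λ' : Set Λ)
    {n : ℕ} (Ib : Fin n → Set I) (Λb : Fin n → Set Λ)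
    (hP : IsGrahamNormalForm P I' Λ' Ib Λb) :
    (P = 0 → rankWithZero (ReesMatrixSemigroup P) = Nat.card G * Nat.card I * Nat.card Λ) ∧
    (P ≠ 0 → rankWithZero (ReesMatrixSemigroup P) =
      max (max I'ᶜ.ncard Λ'ᶜ.ncard)
        (sigmaMin (fun k => entrySubgroup (matrixBlock P (Λb k) (Ib k))) + n - 1)
        + I'.ncard + Λ'.ncard) := by
  refine ⟨ReesMatrixSemigroup.rankWithZero_of_eq_zero, fun hne =>
    ReesMatrixSemigroup.rankWithZero_eq (fun A hA => ?_) (hP.exists_generators hne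
      ((le_max_left _ _).trans (le_max_left _ _)) ((le_max_right _ _).trans (le_max_left _ _))
      (le_max_right _ _))⟩
  have h₁ := hP.ncard_cols_le_card_corePart hne hA
  have h₂ := hP.ncard_rows_le_card_corePart hne hA
  have h₃ := hP.sigmaMin_add_le_card_corePart hne hA
  exact (Nat.add_le_add_right (Nat.add_le_add_right (max_le (max_le h₁ h₂) h₃) _) _).trans
    (hP.card_corePart_add_le hne hA)
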